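/- All rings are associative with unit. For a right $R$-module $M$, let $\operatorname{add} M$ (respectively $\operatorname{Add} M$) denote the class of all right $R$-modules that are isomorphic to direct summands of finite (respectively arbitrary) direct sums of copies of $M$. For a class $\mathcal C$ of right $R$-modules, let $\varinjlim \mathcal C$ denote the class of all right $R$-modules that are direct limits (colimits in the category of right $R$-modules) of direct systems, indexed by directed posets, of modules from $\mathcal C$. Let $R$ be a left noetherian ring. (1) Let $t\in R$ be a central element, let $R[t^{-1}]$ be the localization of $R$ at the multiplicative subset $\{1,t,t^2,\dots\}$, and let $M=R[t^{-1}]/R$ be the cokernel of the localization map $R\to R[t^{-1}]$, viewed as a right $R$-module. Then $\varinjlim\operatorname{add}M=\varinjlim\operatorname{Add}M$. (2) More generally, let $T\subseteq R$ be a countable multiplicative subset (containing $1$) consisting of central elements of $R$, and let $M=T^{-1}R/R$ be the cokernel of the localization map $R\to T^{-1}R$, viewed as a right $R$-module. Then $\varinjlim\operatorname{add}M=\varinjlim\operatorname{Add}M$. -/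

import Mathlib

universe u v w

open CategoryTheory

/-! ### The classes `add M`, `Add M` and `lim→ C`

Right `R`-modules are modules over the opposite ring `Rᵐᵒᵖ`.  Classes of modules over a ring `S`
are `ObjectProperty (ModuleCat S)`. -/

section Classes

variable {S : Type u} [Ring S]

/-- `N` is (isomorphic to) a direct summand of `P`: the identity of `N` factors through `P`. -/
def IsDirectSummandOf (N : Type v) (P : Type w) [AddCommGroup N] [Module S N]
    [AddCommGroup P] [Module S P] : Prop :=
  ∃ (i : N →ₗ[S] P) (p : P →ₗ[S] N), p ∘ₗ i = LinearMap.id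

/-- The class `add M`: direct summands of finite direct sums of copies of `M`. -/
def addClass (M : Type v) [AddCommGroup M] [Module S M] : ObjectProperty (ModuleCat.{w} S) :=
  fun N => ∃ n : ℕ, IsDirectSummandOf (S := S) N (Fin n → M)

/-- The class `Add M`: direct summands of arbitrary direct sums `M^(X)` of copies of `M`. -/
def AddClass (M : Type v) [AddCommGroup M] [Module S M] : ObjectProperty (ModuleCat.{w} S) :=
  fun N => ∃ X : Type w, IsDirectSummandOf (S := S) N (X →₀ M)

/-- The class `lim→ C`: colimits, in the category of all `S`-modules, of direct systems of modules
from `C` indexed by (nonempty) directed posets. -/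
def directLimitClass (C : ObjectProperty (ModuleCat.{w} S)) : ObjectProperty (ModuleCat.{w} S) :=
  fun L => ∃ (I : Type w) (_ : PartialOrder I) (_ : IsDirectedOrder I) (_ : Nonempty I),
    C.colimitsOfShape I L

end Classes

/-! ### Localization at a central multiplicative subset -/

section Localization

variable {R : Type u} [Ring R] (T : Submonoid R) (hT : T ≤ Submonoid.center R)

/-- A multiplicative subset consisting of central elements is an Ore set. -/
@[reducible]
def centralOreSet : OreLocalization.OreSet T where
  ore_right_cancel r₁ r₂ s h := ⟨s, by
    rw [← Submonoid.mem_center_iff.mp (hT s.2) r₁, ← Submonoid.mem_center_iff.mp (hT s.2) r₂, h]⟩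
  oreNum r _ := r
  oreDenom _ s := s
  ore_eq r s := (Submonoid.mem_center_iff.mp (hT s.2) r).symm

/-- The localization `T⁻¹R` of a (noncommutative) ring at a central multiplicative subset. -/
def CentralLocalization : Type u :=
  @OreLocalization R _ T (centralOreSet T hT) R _

noncomputable instance : Ring (CentralLocalization T hT) :=
  letI := centralOreSet T hT
  inferInstanceAs (Ring (OreLocalization T R))

/-- The localization map `R → T⁻¹R`, `r ↦ r / 1`. -/
noncomputable def localizationHom : R →+* CentralLocalization T hT :=
  letI := centralOreSet T hT
  (OreLocalization.numeratorRingHom : R →+* OreLocalization T R)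

/-- `T⁻¹R` as a right `R`-module: `x · r = x * (r / 1)`. -/
noncomputable instance : Module Rᵐᵒᵖ (CentralLocalization T hT) :=
  Module.compHom (CentralLocalization T hT) (localizationHom T hT).op

/-- The localization map as a homomorphism of right `R`-modules. -/
noncomputable def localizationLinearMap : R →ₗ[Rᵐᵒᵖ] CentralLocalization T hT where
  toFun := localizationHom T hT
  map_add' := map_add _
  map_smul' r x := (localizationHom T hT).map_mul x r.unop

/-- The right `R`-module `T⁻¹R / R`, the cokernel of the localization map `R → T⁻¹R`. -/
abbrev GeneralizedPrufer : Type u :=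
  CentralLocalization T hT ⧸ LinearMap.range (localizationLinearMap T hT)

end Localization

/-! The inclusion of `lim→ add M` in `lim→ Add M` is formal. For the converse, let `R` act on `M =
T⁻¹R/R` from the left by `ℓ`, so that maps `M → N` of right modules form a right `R`-module. The
heart of the matter is that for `N` in `Add M` this module is flat over the image of `ℓ`, in the
form of the equational criterion (`exists_solution`): maps `f k` with `∑ f k ∘ ℓ (r k l) = 0` can be
written `f = y C`, where `C` is a matrix over `R` and the entries of `C r` act as zero.

Flatness is proved by successive approximation. At a fraction `e τ`, thought of as `1/τ`, a map into
`M^(X)` is given by coefficients in `R`. The relations then become congruences in `R`, and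
noetherianity supplies both finitely many generators of the solutions of `v r = 0` and one
denominator `σ` absorbing all torsion. This gives `f = c C + f' τ`, where `f'` satisfies the same
relations (`exists_approximation`). Iterating along an enumeration of `T` gives a series for `y`,
which is a finite sum at each element because every element of `M` is killed by the partial products
from some point on.

Given a direct system in `Add M`, consider all maps from finite powers of `M` to its terms, with
matrices as morphisms. Flatness makes this category filtered (`PowerOver.isFiltered`) and makes the
colimit of the powers equal to that of the system (`PowerOver.nonempty_isColimit`). -/

/-! ### Matrices acting on powers of `M`, and pointwise finite sums of maps. -/

section MatrixMap

variable {S R M : Type*} [Ring S] [Ring R] [AddCommGroup M] [Module S M]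
  (ℓ : R →+* Module.End S M)

/-- The linear map between powers of `M` given by a matrix over a ring acting on `M`. -/
def matrixMap {κ ι : Type*} [Fintype κ] (C : Matrix ι κ R) : (κ → M) →ₗ[S] (ι → M) :=
  LinearMap.pi fun i => ∑ k, ℓ (C i k) ∘ₗ LinearMap.proj k

theorem matrixMap_apply {κ ι : Type*} [Fintype κ] (C : Matrix ι κ R) (m : κ → M) (i : ι) :
    matrixMap ℓ C m i = ∑ k, ℓ (C i k) (m k) := by
  simp [matrixMap]

theorem matrixMap_one {κ : Type*} [Fintype κ] [DecidableEq κ] :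
    matrixMap ℓ (1 : Matrix κ κ R) = LinearMap.id := by
  refine LinearMap.ext fun m => funext fun i => ?_
  rw [matrixMap_apply, Finset.sum_eq_single i]
  · simp
  · intro k _ hk
    simp [Matrix.one_apply_ne hk.symm]
  · simp

theorem matrixMap_mul {κ ι μ : Type*} [Fintype κ] [Fintype ι] (C : Matrix μ ι R)
    (D : Matrix ι κ R) : matrixMap ℓ (C * D) = matrixMap ℓ C ∘ₗ matrixMap ℓ D := by
  refine LinearMap.ext fun m => funext fun i => ?_
  simp only [LinearMap.comp_apply, matrixMap_apply, Matrix.mul_apply, map_sum, map_mul,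
    LinearMap.sum_apply, Module.End.mul_apply]
  exact Finset.sum_comm

theorem matrixMap_sub {κ ι : Type*} [Fintype κ] (C D : Matrix ι κ R) :
    matrixMap ℓ (C - D) = matrixMap ℓ C - matrixMap ℓ D := by
  refine LinearMap.ext fun m => funext fun i => ?_
  simp [matrixMap_apply]

/-- The linear map `M → M^(X)` whose components are the actions of the entries of `a`. -/
noncomputable def coeffMap {X : Type*} (a : X →₀ R) : M →ₗ[S] X →₀ M where
  toFun m := a.mapRange (fun b => ℓ b m) (by simp)
  map_add' m m' := by ext x; simp
  map_smul' s m := by ext x; simp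

@[simp]
theorem coeffMap_apply {X : Type*} (a : X →₀ R) (m : M) (x : X) :
    coeffMap ℓ a m x = ℓ (a x) m := by
  simp [coeffMap]

end MatrixMap

section Summation

variable {S M N : Type*} [Ring S] [AddCommGroup M] [Module S M] [AddCommGroup N] [Module S N]

/-- A pointwise eventually vanishing sequence of linear maps can be summed. -/
theorem exists_linearMap_sum (u : ℕ → M →ₗ[S] N)
    (hu : ∀ m, ∃ n₀, ∀ n, n₀ ≤ n → u n m = 0) :
    ∃ g : M →ₗ[S] N, ∀ m n₀, (∀ n, n₀ ≤ n → u n m = 0) →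
      g m = ∑ n ∈ Finset.range n₀, u n m := by
  have hfin (m) (n₀) (h : ∀ n, n₀ ≤ n → u n m = 0) :
      (Function.support fun n => u n m) ⊆ (Finset.range n₀ : Set ℕ) := by
    intro n hn
    by_contra hc
    exact hn (h n (by simpa using hc))
  have hfin' (m) : (Function.support fun n => u n m).Finite := by
    obtain ⟨n₀, h⟩ := hu m
    exact (Finset.finite_toSet _).subset (hfin m n₀ h)
  refine ⟨{ toFun := fun m => ∑ᶠ n, u n m, map_add' := ?_, map_smul' := ?_ }, ?_⟩
  · intro m m'
    simp only [map_add]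
    exact finsum_add_distrib (hfin' m) (hfin' m')
  · intro s m
    simp only [map_smul, RingHom.id_apply]
    exact (smul_finsum' s (hfin' m)).symm
  · intro m n₀ h
    exact finsum_eq_sum_of_support_subset _ (hfin m n₀ h)

/-- A linear map vanishing on the kernel of a surjection factors through it. -/
theorem exists_factor_of_surjective (p : M →ₗ[S] M) (hp : Function.Surjective p)
    (f : M →ₗ[S] N) (h : ∀ m, p m = 0 → f m = 0) : ∃ g : M →ₗ[S] N, f = g ∘ₗ p := by
  have hker : LinearMap.ker p ≤ LinearMap.ker f := fun m hm => h m hm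
  refine ⟨(LinearMap.ker p).liftQ f hker ∘ₗ (p.quotKerEquivOfSurjective hp).symm, ?_⟩
  ext m
  have : (p.quotKerEquivOfSurjective hp).symm (p m) = Submodule.Quotient.mk m := by
    rw [LinearEquiv.symm_apply_eq]
    rfl
  simp [this]

end Summation

/-! ### Uniform denominators in noetherian modules. -/

section Saturation

variable {R M : Type*} [Ring R] [AddCommGroup M] [Module R M] [IsNoetherian R M]

/-- For a submodule `N` of a noetherian module and a central multiplicative set, one denominator
suffices for all elements of the saturation of `N`. -/
theorem exists_uniform_denominator (T : Submonoid R) (hT : T ≤ Submonoid.center R)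
    (N : Submodule R M) :
    ∃ σ ∈ T, ∀ x : M, ∀ τ ∈ T, τ • x ∈ N → σ • x ∈ N := by
  let F : T → Submodule R M := fun τ =>
    { carrier := {x | (τ : R) • x ∈ N}
      add_mem' := fun {x y} hx hy => by
        simp only [Set.mem_ofPred_eq, smul_add] at *
        exact N.add_mem hx hy
      zero_mem' := by simp
      smul_mem' := fun c x hx => by
        simp only [Set.mem_ofPred_eq] at *
        rw [smul_smul, ← Submonoid.mem_center_iff.mp (hT τ.2) c, mul_smul]
        exact N.smul_mem c hx }
  -- A maximal `F σ` is the largest: both `F σ` and `F τ` lie in `F (σ * τ)`, which maximality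
  -- forces to equal `F σ`.
  obtain ⟨_, ⟨σ, rfl⟩, hσ⟩ := set_has_maximal_iff_noetherian.mpr ‹IsNoetherian R M›
    (Set.range F) (Set.range_nonempty F)
  refine ⟨σ, σ.2, fun x τ hτ hx => ?_⟩
  have h1 : F σ ≤ F (σ * ⟨τ, hτ⟩) := by
    intro y (hy : (σ : R) • y ∈ N)
    change ((σ : R) * τ) • y ∈ N
    rw [Submonoid.mem_center_iff.mp (hT hτ) σ, mul_smul]
    exact N.smul_mem _ hy
  have h2 : x ∈ F (σ * ⟨τ, hτ⟩) := by
    change ((σ : R) * τ) • x ∈ N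
    rw [mul_smul]
    exact N.smul_mem _ hx
  by_contra hc
  exact hσ _ ⟨_, rfl⟩ (lt_of_le_of_ne h1 fun h => hc (by rw [← h] at h2; exact h2))

end Saturation

/-! ### Calculus of fractions in `M`, and flatness of the maps `M → M^(X)`. -/

/-- `M` is, as a module with commuting actions of `S` and `R`, generated by "fractions" `e τ` with
central denominators `τ ∈ T`, subject to the relations holding in `T⁻¹R / R`. -/
structure IsCentralPresentation {S R M : Type*} [Ring S] [Ring R] [AddCommGroup M] [Module S M]
    (ℓ : R →+* Module.End S M) (T : Submonoid R) (e : R → M) : Prop where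
  central : T ≤ Submonoid.center R
  act : ∀ σ ∈ T, ∀ τ ∈ T, ℓ σ (e (σ * τ)) = e τ
  gen : ∀ m, ∃ τ ∈ T, ∃ a, m = ℓ a (e τ)
  ker : ∀ τ ∈ T, ∀ a, ℓ a (e τ) = 0 → ∃ b, ℓ a = ℓ (τ * b)
  zero : e 1 = 0
  comm : ∀ a, ∃ s : S, ∀ τ ∈ T, s • e τ = ℓ a (e τ)

namespace IsCentralPresentation

variable {S R M : Type*} [Ring S] [Ring R] [AddCommGroup M] [Module S M]
  {ℓ : R →+* Module.End S M} {T : Submonoid R} {e : R → M}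

theorem mul_comm' (h : IsCentralPresentation ℓ T e) {τ : R} (hτ : τ ∈ T) (a : R) :
    a * τ = τ * a :=
  Submonoid.mem_center_iff.mp (h.central hτ) a

theorem self_act (h : IsCentralPresentation ℓ T e) {τ : R} (hτ : τ ∈ T) : ℓ τ (e τ) = 0 := by
  simpa [h.zero] using h.act τ hτ 1 T.one_mem

theorem mul_act (h : IsCentralPresentation ℓ T e) {τ : R} (hτ : τ ∈ T) (b : R) :
    ℓ (τ * b) (e τ) = 0 := by
  rw [← h.mul_comm' hτ, map_mul, Module.End.mul_apply, h.self_act hτ, map_zero]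

theorem surjective (h : IsCentralPresentation ℓ T e) {τ : R} (hτ : τ ∈ T) :
    Function.Surjective (ℓ τ) := by
  intro m
  obtain ⟨σ, hσ, a, rfl⟩ := h.gen m
  refine ⟨ℓ a (e (τ * σ)), ?_⟩
  rw [← Module.End.mul_apply, ← map_mul, ← h.mul_comm' hτ, map_mul, Module.End.mul_apply,
    h.act τ hτ σ hσ]

theorem cancel (h : IsCentralPresentation ℓ T e) {τ : R} (hτ : τ ∈ T) {N : Type*}
    [AddCommGroup N] [Module S N] {f g : M →ₗ[S] N} (hfg : f ∘ₗ ℓ τ = g ∘ₗ ℓ τ) : f = g := by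
  ext m
  obtain ⟨m, rfl⟩ := h.surjective hτ m
  exact LinearMap.congr_fun hfg m

theorem cancel_mul (h : IsCentralPresentation ℓ T e) {τ : R} (hτ : τ ∈ T) {a b : R}
    (hab : ℓ (τ * a) = ℓ (τ * b)) : ℓ a = ℓ b := by
  rw [← h.mul_comm' hτ, ← h.mul_comm' hτ, map_mul, map_mul] at hab
  exact h.cancel hτ hab

/-- Write `m = a/σ = τa/(τσ)`. That `τ` kills `m` means that `τ(τa)` acts as `τσb` for some `b`.
Cancelling one `τ`, `τa` acts as `σb`, hence `m = σb/(τσ) = b/τ`. -/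
theorem exists_of_act_eq_zero (h : IsCentralPresentation ℓ T e) {τ : R} (hτ : τ ∈ T) {m : M}
    (hm : ℓ τ m = 0) : ∃ a, m = ℓ a (e τ) := by
  obtain ⟨σ, hσ, a, rfl⟩ := h.gen m
  have h1 : ℓ a (e σ) = ℓ (τ * a) (e (τ * σ)) := by
    rw [← h.mul_comm' hτ, map_mul, Module.End.mul_apply, h.act τ hτ σ hσ]
  rw [h1, ← Module.End.mul_apply, ← map_mul] at hm
  obtain ⟨b, hb⟩ := h.ker _ (T.mul_mem hτ hσ) _ hm
  rw [mul_assoc τ σ b] at hb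
  refine ⟨b, ?_⟩
  rw [h1, h.cancel_mul hτ hb, h.mul_comm' hσ τ, ← h.mul_comm' hσ b, map_mul,
    Module.End.mul_apply, h.act σ hσ τ hτ]

/-- The map `f` need not commute with `ℓ`, but at `e τ` the action of `b` is a scalar from `S`, and
`S`-linearity applies. -/
theorem map_act (h : IsCentralPresentation ℓ T e) {X : Type*} (f : M →ₗ[S] X →₀ M) {τ : R}
    (hτ : τ ∈ T) {a : X →₀ R} (hf : f (e τ) = coeffMap ℓ a (e τ)) (b : R) :
    f (ℓ b (e τ)) = coeffMap ℓ a (ℓ b (e τ)) := by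
  obtain ⟨s, hs⟩ := h.comm b
  rw [← hs τ hτ, map_smul, map_smul, hf]

/-- A map out of `M` is given at `e τ` by multiplication by some coefficients. -/
theorem exists_coeff (h : IsCentralPresentation ℓ T e) {X : Type*} (f : M →ₗ[S] X →₀ M)
    {τ : R} (hτ : τ ∈ T) : ∃ a : X →₀ R, f (e τ) = coeffMap ℓ a (e τ) := by
  classical
  have key (x : X) : ∃ a, f (e τ) x = ℓ a (e τ) := by
    apply h.exists_of_act_eq_zero hτ
    obtain ⟨s, hs⟩ := h.comm τ
    have : s • f (e τ) = 0 := by rw [← map_smul, hs τ hτ, h.self_act hτ, map_zero]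
    obtain ⟨σ, hσ, b, hb⟩ := h.gen (f (e τ) x)
    have h2 : s • f (e τ) x = 0 := by rw [← Finsupp.smul_apply, this, Finsupp.zero_apply]
    rw [hb] at h2 ⊢
    rwa [← map_smul, hs σ hσ, ← Module.End.mul_apply, ← map_mul, h.mul_comm' hτ, map_mul,
      Module.End.mul_apply] at h2
  choose a ha using key
  refine ⟨Finsupp.onFinset (f (e τ)).support
    (fun x => if x ∈ (f (e τ)).support then a x else 0) (fun x hx => ?_), ?_⟩
  · by_contra hc
    exact hx (if_neg hc)
  · ext x
    rw [coeffMap_apply, Finsupp.onFinset_apply]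
    split_ifs with hx
    · exact ha x
    · simpa using hx

/-- A map vanishing at `e τ` is divisible by `τ`. -/
theorem exists_factor (h : IsCentralPresentation ℓ T e) {N : Type*} [AddCommGroup N] [Module S N]
    (f : M →ₗ[S] N) {τ : R} (hτ : τ ∈ T) (hf : f (e τ) = 0) :
    ∃ g : M →ₗ[S] N, f = g ∘ₗ ℓ τ := by
  apply exists_factor_of_surjective _ (h.surjective hτ)
  intro m hm
  -- The kernel of `ℓ τ` consists of `S`-multiples of `e τ`, so `f` vanishes on it.
  obtain ⟨a, rfl⟩ := h.exists_of_act_eq_zero hτ hm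
  obtain ⟨s, hs⟩ := h.comm a
  rw [← hs τ hτ, map_smul, hf, smul_zero]

/-- Finitely many elements of `M` have a common denominator. -/
theorem exists_common_denominator (h : IsCentralPresentation ℓ T e) {κ : Type*} [Finite κ]
    (m : κ → M) : ∃ τ ∈ T, ∃ a : κ → R, ∀ k, m k = ℓ (a k) (e τ) := by
  classical
  have key (s : Set κ) (hs : s.Finite) : ∃ τ ∈ T, ∀ k ∈ s, ∃ a, m k = ℓ a (e τ) := by
    induction s, hs using Set.Finite.induction_on with
    | empty => exact ⟨1, T.one_mem, by simp⟩
    | @insert k s _ _ ih =>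
      obtain ⟨τ, hτ, ih⟩ := ih
      obtain ⟨σ, hσ, a, ha⟩ := h.gen (m k)
      refine ⟨τ * σ, T.mul_mem hτ hσ, ?_⟩
      rintro j (rfl | hj)
      · refine ⟨a * τ, ?_⟩
        rw [ha, map_mul, Module.End.mul_apply, h.act τ hτ σ hσ]
      · obtain ⟨b, hb⟩ := ih j hj
        refine ⟨b * σ, ?_⟩
        rw [hb, h.mul_comm' hσ τ, map_mul, Module.End.mul_apply, h.act σ hσ τ hτ]
  obtain ⟨τ, hτ, H⟩ := key Set.univ Set.finite_univ
  choose a ha using fun k => H k trivial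
  exact ⟨τ, hτ, a, ha⟩

open Matrix in
/-- Modulo any denominator, a family of maps `M → M^(X)` satisfying the linear relations `r` is a
combination of the solutions of `r` over `R`. -/
theorem exists_approximation [IsNoetherianRing R] (h : IsCentralPresentation ℓ T e)
    {κ ι : Type*} [Fintype κ] [Finite ι] (r : Matrix κ ι R) (X : Type*) :
    ∃ (q : ℕ) (C : Matrix (Fin q) κ R), (∀ j l, ℓ ((C * r) j l) = 0) ∧
      ∀ f : κ → M →ₗ[S] X →₀ M, (∀ l, ∑ k, f k ∘ₗ ℓ (r k l) = 0) → ∀ τ ∈ T,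
        ∃ (c : Fin q → X →₀ R) (f' : κ → M →ₗ[S] X →₀ M),
          (∀ l, ∑ k, f' k ∘ₗ ℓ (r k l) = 0) ∧
          ∀ k, f k = (∑ j, coeffMap ℓ (c j) ∘ₗ ℓ (C j k)) + f' k ∘ₗ ℓ τ := by
  classical
  have := Fintype.ofFinite ι
  let H : Submodule R (κ → R) :=
    { carrier := {v | ∀ l, ℓ ((v ᵥ* r) l) = 0}
      add_mem' := fun {v w} hv hw l => by simp [add_vecMul, hv l, hw l]
      zero_mem' := by simp
      smul_mem' := fun a v hv l => by simp [smul_vecMul, hv l] }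
  -- `H` consists of the solutions and `N` of the row combinations of `r`, both modulo the kernel of
  -- `ℓ`. They depend on `r` alone, so the `C` and `σ` obtained from them serve all `f` and `τ`.
  let N : Submodule R (ι → R) :=
    { carrier := {x | ∃ v : κ → R, ∀ l, ℓ (x l) = ℓ ((v ᵥ* r) l)}
      add_mem' := by
        rintro x y ⟨v, hv⟩ ⟨w, hw⟩
        exact ⟨v + w, fun l => by simp [add_vecMul, hv l, hw l]⟩
      zero_mem' := ⟨0, by simp⟩
      smul_mem' := by
        rintro a x ⟨v, hv⟩
        exact ⟨a • v, fun l => by simp [smul_vecMul, hv l]⟩ }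
  obtain ⟨q, C, hC⟩ := Submodule.fg_iff_exists_fin_generating_family.mp
    (IsNoetherian.noetherian H)
  obtain ⟨σ, hσ, hN⟩ := exists_uniform_denominator T h.central N
  have hCH (j) : C j ∈ H := hC ▸ Submodule.subset_span ⟨j, rfl⟩
  refine ⟨q, C, fun j l => hCH j l, fun f hf τ hτ => ?_⟩
  have hστ := T.mul_mem hσ hτ
  -- Coefficients are taken at `e (σ * τ)` rather than `e τ`: the extra factor `σ` pays for the
  -- saturation of `N`.
  choose a ha using fun k => h.exists_coeff (f k) hστ
  have key (x : X) : ∃ c : Fin q → R, (∃ w : κ → R, ∀ k, a k x = ∑ j, c j * C j k + τ * w k) ∧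
      ((∀ k, a k x = 0) → c = 0) := by
    -- Choosing `c = 0` here makes the assembled coefficients `c'` finitely supported.
    by_cases hx : ∀ k, a k x = 0
    · exact ⟨0, ⟨0, by simp [hx]⟩, fun _ => rfl⟩
    have h1 (l) : ∃ b, ℓ (((fun k => a k x) ᵥ* r) l) = ℓ (σ * τ * b) := by
      apply h.ker _ hστ
      have h2 := DFunLike.congr_fun (LinearMap.congr_fun (hf l) (e (σ * τ))) x
      simp only [LinearMap.sum_apply, LinearMap.comp_apply, h.map_act (f _) hστ (ha _),
        Finsupp.finsetSum_apply, coeffMap_apply, LinearMap.zero_apply, Finsupp.zero_apply] at h2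
      simpa [vecMul, dotProduct] using h2
    choose b hb using h1
    -- Since `a r = στb` modulo the kernel of `ℓ`, `τσb` lies in `N`, and the uniform denominator
    -- removes `τ`. Thus `σb` is `w r` for some `w`, and `a - τw` solves the relations.
    have h3 : σ • b ∈ N := by
      refine hN b (τ * σ) (T.mul_mem hτ hσ) ⟨fun k => a k x, fun l => ?_⟩
      rw [hb, Pi.smul_apply, smul_eq_mul, h.mul_comm' hσ τ]
    obtain ⟨w, hw⟩ := h3
    have h4 : (fun k => a k x) - τ • w ∈ H := by
      intro l
      rw [sub_vecMul, Pi.sub_apply, map_sub, hb, smul_vecMul, Pi.smul_apply, smul_eq_mul,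
        map_mul ℓ τ, ← hw, ← map_mul, Pi.smul_apply, smul_eq_mul, ← mul_assoc, h.mul_comm' hσ τ, sub_self]
    rw [← hC, Submodule.mem_span_range_iff_exists_fun] at h4
    obtain ⟨c, hc⟩ := h4
    refine ⟨c, ⟨w, fun k => ?_⟩, fun hx' => absurd hx' hx⟩
    have h5 := congr_fun hc k
    simp only [Finset.sum_apply, Pi.smul_apply, smul_eq_mul, Pi.sub_apply] at h5
    rw [h5, sub_add_cancel]
  choose c hc hc0 using key
  let c' (j : Fin q) : X →₀ R := Finsupp.onFinset (Finset.univ.biUnion fun k => (a k).support)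
    (fun x => c x j) fun x hx => by
      by_contra hx'
      apply hx
      rw [hc0 x, Pi.zero_apply]
      intro k
      by_contra hk
      exact hx' (Finset.mem_biUnion.mpr ⟨k, Finset.mem_univ _, Finsupp.mem_support_iff.mpr hk⟩)
  have h6 (k) : (f k - ∑ j, coeffMap ℓ (c' j) ∘ₗ ℓ (C j k)) (e τ) = 0 := by
    have h7 : f k (e τ) = coeffMap ℓ (a k) (e τ) := by
      rw [← h.act σ hσ τ hτ, h.map_act _ hστ (ha k)]
    ext x
    obtain ⟨w, hw⟩ := hc x
    simp only [LinearMap.sub_apply, h7, LinearMap.sum_apply, LinearMap.comp_apply,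
      Finsupp.sub_apply, Finsupp.finsetSum_apply, coeffMap_apply, hw k, map_add, map_sum, map_mul,
      LinearMap.add_apply, Module.End.mul_apply, c', Finsupp.onFinset_apply, add_sub_cancel_left,
      Finsupp.zero_apply]
    rw [← Module.End.mul_apply, ← map_mul, h.mul_act hτ]
  choose f' hf' using fun k => h.exists_factor _ hτ (h6 k)
  refine ⟨c', f', fun l => ?_, fun k => by rw [← hf' k]; abel⟩
  -- As `τ` is central and `ℓ τ` is surjective, the relations for `f'` may be checked after
  -- composing with `ℓ τ`, where `f' ∘ ℓ τ` is a difference of two families satisfying them.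
  apply h.cancel hτ
  have h8 : (∑ k, f' k ∘ₗ ℓ (r k l)) ∘ₗ ℓ τ = ∑ k, (f' k ∘ₗ ℓ τ) ∘ₗ ℓ (r k l) := by
    ext1 m
    simp only [LinearMap.comp_apply, LinearMap.sum_apply, ← Module.End.mul_apply, ← map_mul,
      h.mul_comm' hτ]
  rw [h8]
  simp only [← hf', LinearMap.sub_comp, Finset.sum_sub_distrib, hf l, zero_sub, LinearMap.zero_comp,
    neg_eq_zero]
  ext1 m
  simp only [LinearMap.sum_apply, LinearMap.comp_apply, LinearMap.zero_apply]
  rw [Finset.sum_comm]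
  refine Finset.sum_eq_zero fun j _ => ?_
  rw [← map_sum]
  have h9 := LinearMap.congr_fun (hCH j l) m
  simp only [vecMul, dotProduct, map_sum, map_mul, LinearMap.sum_apply, Module.End.mul_apply,
    LinearMap.zero_apply] at h9
  rw [h9, map_zero]

/-- A countable `T` contains a sequence whose partial products annihilate all elements of `M`. -/
theorem exists_sequence (h : IsCentralPresentation ℓ T e) (hT : (T : Set R).Countable) :
    ∃ τ : ℕ → R, (∀ n, τ n ∈ T) ∧ ∃ t : ℕ → R, t 0 = 1 ∧ (∀ n, t (n + 1) = τ n * t n) ∧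
      ∀ m, ∃ n₀, ∀ n, n₀ ≤ n → ℓ (t n) m = 0 := by
  obtain ⟨τ, hτ⟩ := hT.exists_eq_range ⟨1, T.one_mem⟩
  have hτT (n) : τ n ∈ T := by
    have : τ n ∈ (T : Set R) := hτ ▸ ⟨n, rfl⟩
    exact this
  let t : ℕ → R := fun n => Nat.rec 1 (fun n x => τ n * x) n
  refine ⟨τ, hτT, t, rfl, fun n => rfl, fun m => ?_⟩
  have ht (n) : t (n + 1) = τ n * t n := rfl
  have htT (n) : t n ∈ T := by
    induction n with
    | zero => exact T.one_mem
    | succ n ih => exact T.mul_mem (hτT n) ih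
  obtain ⟨σ, hσ, a, rfl⟩ := h.gen m
  obtain ⟨n₀, rfl⟩ : σ ∈ Set.range τ := hτ ▸ hσ
  refine ⟨n₀ + 1, fun n hn => ?_⟩
  induction n, hn using Nat.le_induction with
  | base =>
    rw [← Module.End.mul_apply, ← map_mul, ht, mul_assoc, h.mul_act hσ]
  | succ n hn ih =>
    -- Once the factor `τ n₀` has entered the product, later factors act on zero.
    rw [ht, map_mul, Module.End.mul_apply, ih, map_zero]

/-- The maps `M → M^(X)` satisfying given linear relations over `R` come from solutions of these
relations over `R`: the module of maps `M → M^(X)` is flat over `R`. -/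
theorem exists_solution [IsNoetherianRing R] (h : IsCentralPresentation ℓ T e)
    (hT : (T : Set R).Countable) {κ ι : Type*} [Fintype κ] [Finite ι] (r : Matrix κ ι R)
    {X : Type*} (f : κ → M →ₗ[S] X →₀ M) (hf : ∀ l, ∑ k, f k ∘ₗ ℓ (r k l) = 0) :
    ∃ (q : ℕ) (C : Matrix (Fin q) κ R) (y : Fin q → M →ₗ[S] X →₀ M),
      (∀ k, f k = ∑ j, y j ∘ₗ ℓ (C j k)) ∧ ∀ j l, ℓ ((C * r) j l) = 0 := by
  obtain ⟨q, C, hC, step⟩ := h.exists_approximation r X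
  obtain ⟨τ, hτT, t, ht0, ht, htm⟩ := h.exists_sequence hT
  choose! c f' hf' hstep using step
  -- `F n` is the remainder after `n` approximation steps, the step from `n` to `n + 1` being taken
  -- modulo `τ n`.
  let F : ℕ → κ → M →ₗ[S] X →₀ M := fun n => Nat.rec f (fun n g => f' g (τ n)) n
  have hFs (n) : F (n + 1) = f' (F n) (τ n) := rfl
  have hF (n) : ∀ l, ∑ k, F n k ∘ₗ ℓ (r k l) = 0 := by
    induction n with
    | zero => exact hf
    | succ n ih => exact hf' _ ih _ (hτT n)
  have hc (j : Fin q) (m) (n₀) (hm : ∀ n, n₀ ≤ n → ℓ (t n) m = 0) (n) (hn : n₀ ≤ n) :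
      (coeffMap ℓ (c (F n) (τ n) j) ∘ₗ ℓ (t n)) m = 0 := by
    rw [LinearMap.comp_apply, hm n hn, map_zero]
  choose y hy using fun j : Fin q =>
    exists_linearMap_sum (fun n => coeffMap ℓ (c (F n) (τ n) j) ∘ₗ ℓ (t n))
      fun m => (htm m).imp fun n₀ => hc j m n₀
  have htc (n a) : a * t n = t n * a := by
    induction n with
    | zero => simp [ht0]
    | succ n ih => rw [ht, ← mul_assoc, h.mul_comm' (hτT n), mul_assoc, ih, mul_assoc]
  refine ⟨q, C, y, fun k => ?_, hC⟩
  -- The approximations telescope: `f = ∑_{i<n} c_i t_i C + F n ∘ t_n`. At a given `m` the last term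
  -- vanishes for large `n`.
  have partial_sum (n) (m) : f k m = (∑ i ∈ Finset.range n,
      ∑ j, coeffMap ℓ (c (F i) (τ i) j) (ℓ (t i) (ℓ (C j k) m))) + F n k (ℓ (t n) m) := by
    induction n with
    | zero => simp [ht0, F]
    | succ n ih =>
      rw [ih, Finset.sum_range_succ, add_assoc, hstep (F n) (hF n) (τ n) (hτT n) k, ht, hFs]
      simp only [LinearMap.add_apply, LinearMap.sum_apply, LinearMap.comp_apply, map_mul,
        Module.End.mul_apply]
      congr 2
      refine Finset.sum_congr rfl fun j _ => ?_
      rw [← Module.End.mul_apply, ← Module.End.mul_apply, ← map_mul, ← map_mul, htc]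
  ext1 m
  obtain ⟨n₀, hn₀⟩ := htm m
  have hn₁ (j) (n) (hn : n₀ ≤ n) : ℓ (t n) (ℓ (C j k) m) = 0 := by
    rw [← Module.End.mul_apply, ← map_mul, ← htc, map_mul, Module.End.mul_apply, hn₀ n hn,
      map_zero]
  rw [partial_sum n₀, hn₀ n₀ le_rfl, map_zero, add_zero, Finset.sum_comm, LinearMap.sum_apply]
  refine Finset.sum_congr rfl fun j _ => ?_
  rw [LinearMap.comp_apply, hy j _ n₀ (hc j _ n₀ (hn₁ j))]
  rfl

end IsCentralPresentation

/-! ### Maps from powers of `M` to modules in `Add M`. -/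

section MatrixMapLemmas

variable {S R M N : Type*} [Ring S] [Ring R] [AddCommGroup M] [Module S M] [AddCommGroup N]
  [Module S N] (ℓ : R →+* Module.End S M)

theorem matrixMap_eq_zero {κ ι : Type*} [Fintype κ] {C : Matrix ι κ R}
    (hC : ∀ i k, ℓ (C i k) = 0) : matrixMap ℓ C = 0 := by
  refine LinearMap.ext fun m => funext fun i => ?_
  simp [matrixMap_apply, hC]

theorem comp_matrixMap_single {κ ι : Type*} [Fintype κ] [DecidableEq κ] [Fintype ι]
    [DecidableEq ι] (f : (ι → M) →ₗ[S] N) (C : Matrix ι κ R) (k : κ) :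
    f ∘ₗ matrixMap ℓ C ∘ₗ LinearMap.single S (fun _ => M) k =
      ∑ i, (f ∘ₗ LinearMap.single S (fun _ => M) i) ∘ₗ ℓ (C i k) := by
  refine LinearMap.ext fun m => ?_
  have : matrixMap ℓ C (Pi.single k m) = ∑ i, Pi.single i (ℓ (C i k) m) := by
    rw [Finset.univ_sum_single]
    funext i
    rw [matrixMap_apply, Finset.sum_eq_single k]
    · rw [Pi.single_eq_same]
    · intro j _ hj
      rw [Pi.single_eq_of_ne hj, map_zero]
    · simp
  simp [this]

theorem eq_sum_comp_matrixMap {κ ι : Type*} [Fintype κ] [DecidableEq κ] [Fintype ι]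
    (f : (κ → M) →ₗ[S] N) (y : ι → M →ₗ[S] N) (C : Matrix ι κ R)
    (h : ∀ k, f ∘ₗ LinearMap.single S (fun _ => M) k = ∑ j, y j ∘ₗ ℓ (C j k)) :
    f = (∑ j, y j ∘ₗ LinearMap.proj j) ∘ₗ matrixMap ℓ C := by
  refine LinearMap.ext fun m => ?_
  have h1 (k) : f (Pi.single k (m k)) = ∑ j, y j (ℓ (C j k) (m k)) := by
    simpa using LinearMap.congr_fun (h k) (m k)
  rw [← Finset.univ_sum_single m, map_sum, Finset.univ_sum_single]
  simp only [h1, LinearMap.comp_apply, LinearMap.sum_apply, LinearMap.proj_apply, matrixMap_apply,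
    map_sum]
  exact Finset.sum_comm

/-- Two maps from powers of `M` to the same module factor through a common one. -/
theorem exists_common_factor {n p : ℕ} (f : (Fin n → M) →ₗ[S] N) (g : (Fin p → M) →ₗ[S] N) :
    ∃ (q : ℕ) (C : Matrix (Fin q) (Fin n) R) (D : Matrix (Fin q) (Fin p) R)
      (h : (Fin q → M) →ₗ[S] N), h ∘ₗ matrixMap ℓ C = f ∧ h ∘ₗ matrixMap ℓ D = g := by
  -- The common factor is `(f, g)` on the direct sum of the two powers; `C` and `D` are the two
  -- inclusions.
  let ε : Fin (n + p) ≃ Fin n ⊕ Fin p := finSumFinEquiv.symm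
  let C : Matrix (Fin n ⊕ Fin p) (Fin n) R := Matrix.fromRows 1 0
  let D : Matrix (Fin n ⊕ Fin p) (Fin p) R := Matrix.fromRows 0 1
  have h1 (m) (k : Fin n) : matrixMap ℓ C m (Sum.inl k) = m k :=
    congr_fun (LinearMap.congr_fun (matrixMap_one (S := S) ℓ (κ := Fin n)) m) k
  have h2 (m) (k : Fin p) : matrixMap ℓ C m (Sum.inr k) = 0 := by simp [C, matrixMap_apply]
  have h3 (m) (k : Fin n) : matrixMap ℓ D m (Sum.inl k) = 0 := by simp [D, matrixMap_apply]
  have h4 (m) (k : Fin p) : matrixMap ℓ D m (Sum.inr k) = m k :=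
    congr_fun (LinearMap.congr_fun (matrixMap_one (S := S) ℓ (κ := Fin p)) m) k
  refine ⟨n + p, C.submatrix ε id, D.submatrix ε id,
    f ∘ₗ LinearMap.funLeft S M (fun k => ε.symm (Sum.inl k)) +
      g ∘ₗ LinearMap.funLeft S M (fun k => ε.symm (Sum.inr k)), ?_, ?_⟩
  · refine LinearMap.ext fun m => ?_
    have e1 : LinearMap.funLeft S M (fun k => ε.symm (Sum.inl k))
        (matrixMap ℓ (C.submatrix ε id) m) = m := by
      funext k
      simpa [LinearMap.funLeft_apply, matrixMap_apply] using h1 m k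
    have e2 : LinearMap.funLeft S M (fun k => ε.symm (Sum.inr k))
        (matrixMap ℓ (C.submatrix ε id) m) = 0 := by
      funext k
      simpa [LinearMap.funLeft_apply, matrixMap_apply] using h2 m k
    simp [e1, e2]
  · refine LinearMap.ext fun m => ?_
    have e1 : LinearMap.funLeft S M (fun k => ε.symm (Sum.inl k))
        (matrixMap ℓ (D.submatrix ε id) m) = 0 := by
      funext k
      simpa [LinearMap.funLeft_apply, matrixMap_apply] using h3 m k
    have e2 : LinearMap.funLeft S M (fun k => ε.symm (Sum.inr k))
        (matrixMap ℓ (D.submatrix ε id) m) = m := by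
      funext k
      simpa [LinearMap.funLeft_apply, matrixMap_apply] using h4 m k
    simp [e1, e2]

/-- Every element of a module in `Add M` is in the image of a power of `M`. -/
theorem exists_mem_image_power {X : Type*} (hN : IsDirectSummandOf (S := S) N (X →₀ M)) (y : N) :
    ∃ (n : ℕ) (g : (Fin n → M) →ₗ[S] N) (m : Fin n → M), g m = y := by
  obtain ⟨i, p, hp⟩ := hN
  let ε := (i y).support.equivFin
  refine ⟨_, p ∘ₗ ∑ k, Finsupp.lsingle (ε.symm k : X) ∘ₗ LinearMap.proj k,
    fun k => i y (ε.symm k), ?_⟩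
  have h1 : ∑ k, Finsupp.single (ε.symm k : X) (i y (ε.symm k)) = i y := by
    rw [Equiv.sum_comp ε.symm (fun x => Finsupp.single (x : X) (i y x)),
      Finset.sum_coe_sort _ (fun x => Finsupp.single x (i y x))]
    exact Finsupp.sum_single _
  have h2 := LinearMap.congr_fun hp y
  simp only [LinearMap.comp_apply, LinearMap.id_apply] at h2
  simp [h1, h2]

end MatrixMapLemmas

namespace IsCentralPresentation

variable {S R M N : Type*} [Ring S] [Ring R] [IsNoetherianRing R] [AddCommGroup M] [Module S M]
  [AddCommGroup N] [Module S N] {ℓ : R →+* Module.End S M} {T : Submonoid R} {e : R → M}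

/-- A map from a power of `M` to a module in `Add M` killing a matrix factors through a matrix
killing that matrix. -/
theorem exists_factor_matrixMap (h : IsCentralPresentation ℓ T e) (hT : (T : Set R).Countable)
    {X : Type*} (hN : IsDirectSummandOf (S := S) N (X →₀ M)) {n p : ℕ}
    (f : (Fin p → M) →ₗ[S] N) (C : Matrix (Fin p) (Fin n) R) (hf : f ∘ₗ matrixMap ℓ C = 0) :
    ∃ (q : ℕ) (D : Matrix (Fin q) (Fin p) R) (g : (Fin q → M) →ₗ[S] N),
      f = g ∘ₗ matrixMap ℓ D ∧ matrixMap ℓ D ∘ₗ matrixMap ℓ C = 0 := by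
  obtain ⟨i, π, hπ⟩ := hN
  obtain ⟨q, D, y, hy, hD⟩ := h.exists_solution hT C
    (fun k => (i ∘ₗ f) ∘ₗ LinearMap.single S (fun _ => M) k) fun l => by
      rw [← comp_matrixMap_single, ← LinearMap.comp_assoc, LinearMap.comp_assoc (matrixMap ℓ C), hf]
      simp
  refine ⟨q, D, π ∘ₗ ∑ j, y j ∘ₗ LinearMap.proj j, ?_, ?_⟩
  · have h1 : i ∘ₗ f = (∑ j, y j ∘ₗ LinearMap.proj j) ∘ₗ matrixMap ℓ D :=
      eq_sum_comp_matrixMap ℓ _ _ _ hy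
    rw [LinearMap.comp_assoc, ← h1, ← LinearMap.comp_assoc, hπ, LinearMap.id_comp]
  · rw [← matrixMap_mul]
    exact matrixMap_eq_zero ℓ hD

/-- A map from a power of `M` to a module in `Add M` killing an element factors through a matrix
killing that element. -/
theorem exists_factor_apply (h : IsCentralPresentation ℓ T e) (hT : (T : Set R).Countable)
    {X : Type*} (hN : IsDirectSummandOf (S := S) N (X →₀ M)) {p : ℕ}
    (f : (Fin p → M) →ₗ[S] N) (m : Fin p → M) (hf : f m = 0) :
    ∃ (q : ℕ) (D : Matrix (Fin q) (Fin p) R) (g : (Fin q → M) →ₗ[S] N),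
      f = g ∘ₗ matrixMap ℓ D ∧ matrixMap ℓ D m = 0 := by
  obtain ⟨τ, hτ, a, ha⟩ := h.exists_common_denominator m
  have hfa : (∑ k, (f ∘ₗ LinearMap.single S (fun _ => M) k) ∘ₗ ℓ (a k)) (e τ) = 0 := by
    have h1 : ∑ k, Pi.single k (ℓ (a k) (e τ)) = m := by
      rw [Finset.univ_sum_single]
      exact funext fun k => (ha k).symm
    simp only [LinearMap.sum_apply, LinearMap.comp_apply, LinearMap.single_apply]
    rw [← map_sum, h1, hf]
  obtain ⟨b, hb⟩ := h.exists_factor _ hτ hfa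
  -- Vanishing at `m` is turned into the linear relation `∑ f_k a_k - b τ = 0` in the enlarged
  -- family `(f, b)`.
  let r : Matrix (Fin p ⊕ Unit) Unit R := Sum.elim (fun k _ => a k) fun _ _ => -τ
  obtain ⟨i, π, hπ⟩ := hN
  obtain ⟨q, D, y, hy, hD⟩ := h.exists_solution hT r
    (Sum.elim (fun k => (i ∘ₗ f) ∘ₗ LinearMap.single S (fun _ => M) k) fun _ => i ∘ₗ b) fun l => by
      have h2 := congr_arg (fun g => i ∘ₗ g) hb
      refine LinearMap.ext fun x => ?_
      have h3 := LinearMap.congr_fun h2 x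
      simp only [LinearMap.comp_apply, LinearMap.sum_apply, map_sum,
        LinearMap.single_apply] at h3
      simp [r, h3]
  refine ⟨q, D.submatrix id Sum.inl, π ∘ₗ ∑ j, y j ∘ₗ LinearMap.proj j, ?_, ?_⟩
  · have h1 : i ∘ₗ f = (∑ j, y j ∘ₗ LinearMap.proj j) ∘ₗ matrixMap ℓ (D.submatrix id Sum.inl) :=
      eq_sum_comp_matrixMap ℓ _ _ _ fun k => hy (Sum.inl k)
    rw [LinearMap.comp_assoc, ← h1, ← LinearMap.comp_assoc, hπ, LinearMap.id_comp]
  · funext j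
    -- Evaluated at `e τ`, the term coming from `-τ` disappears, since `τ` kills `e τ`.
    have h4 := LinearMap.congr_fun (hD j ()) (e τ)
    rw [Matrix.mul_apply, Fintype.sum_sum_type] at h4
    have hr₁ (k) : r (Sum.inl k) () = a k := rfl
    have hr₂ : r (Sum.inr ()) () = -τ := rfl
    simp only [hr₁, Finset.univ_unique, PUnit.default_eq_unit, Finset.sum_singleton, hr₂, mul_neg,
      map_add, map_neg, map_sum, map_mul, LinearMap.add_apply, LinearMap.sum_apply,
      LinearMap.neg_apply, Module.End.mul_apply, h.self_act hτ, map_zero, neg_zero, add_zero,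
      LinearMap.zero_apply] at h4
    rw [matrixMap_apply]
    simpa [ha] using h4

end IsCentralPresentation

/-! ### The bimodule `T⁻¹R / R` as a central presentation. -/

section Localization

variable {R : Type u} [Ring R] (T : Submonoid R) (hT : T ≤ Submonoid.center R)

theorem isUnit_localizationHom {τ : R} (hτ : τ ∈ T) : IsUnit (localizationHom T hT τ) :=
  let := centralOreSet T hT
  OreLocalization.numerator_isUnit (⟨τ, hτ⟩ : T)

/-- Every element of `T⁻¹R` has a denominator in `T`. -/
theorem exists_mul_localizationHom (q : CentralLocalization T hT) :
    ∃ τ ∈ T, ∃ a, localizationHom T hT τ * q = localizationHom T hT a := by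
  let := centralOreSet T hT
  obtain ⟨a, τ, rfl⟩ : ∃ (a : R) (τ : T), q = a /ₒ τ := by
    induction q using OreLocalization.ind with
    | _ r s => exact ⟨r, s, rfl⟩
  refine ⟨τ, τ.2, a, ?_⟩
  exact (OreLocalization.mul_cancel (r := a) (s := τ) (t := 1))

theorem commute_localizationHom {τ : R} (hτ : τ ∈ T) (q : CentralLocalization T hT) :
    Commute (localizationHom T hT τ) q := by
  obtain ⟨σ, hσ, a, ha⟩ := exists_mul_localizationHom T hT q
  have hc (b : R) : Commute (localizationHom T hT τ) (localizationHom T hT b) := by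
    rw [Commute, SemiconjBy, ← map_mul, ← map_mul, Submonoid.mem_center_iff.mp (hT hτ) b]
  -- Multiplying by a denominator of `q` reduces the claim to elements coming from `R`.
  apply (isUnit_localizationHom T hT hσ).mul_left_cancel
  rw [← mul_assoc, ← (hc σ).eq, mul_assoc, ha, ← mul_assoc, ha, (hc a).eq]

theorem mem_range_localizationLinearMap {q : CentralLocalization T hT} :
    q ∈ LinearMap.range (localizationLinearMap T hT) ↔ ∃ a, localizationHom T hT a = q :=
  Iff.rfl

theorem smul_localization (s : Rᵐᵒᵖ) (q : CentralLocalization T hT) :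
    s • q = q * localizationHom T hT s.unop := rfl

/-- Left multiplication by `a` on `T⁻¹R`, as a map of right `R`-modules. -/
noncomputable def localizationMulLeft (a : R) :
    CentralLocalization T hT →ₗ[Rᵐᵒᵖ] CentralLocalization T hT where
  toFun q := localizationHom T hT a * q
  map_add' := mul_add _
  map_smul' s q := by
    simp only [smul_localization, RingHom.id_apply, mul_assoc]

/-- The left action of `R` on `T⁻¹R / R` by endomorphisms of right `R`-modules. -/
noncomputable def pruferMulLeft : R →+* Module.End Rᵐᵒᵖ (GeneralizedPrufer T hT) where
  toFun a := Submodule.mapQ _ _ (localizationMulLeft T hT a) (by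
    rintro _ ⟨b, rfl⟩
    exact ⟨a * b, map_mul (localizationHom T hT) a b⟩)
  map_one' := by
    refine LinearMap.ext fun m => ?_
    obtain ⟨q, rfl⟩ := Submodule.Quotient.mk_surjective _ m
    simp [localizationMulLeft]
  map_mul' a b := by
    refine LinearMap.ext fun m => ?_
    obtain ⟨q, rfl⟩ := Submodule.Quotient.mk_surjective _ m
    simp [localizationMulLeft, mul_assoc]
    rfl
  map_zero' := by
    refine LinearMap.ext fun m => ?_
    obtain ⟨q, rfl⟩ := Submodule.Quotient.mk_surjective _ m
    simp [localizationMulLeft]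
  map_add' a b := by
    refine LinearMap.ext fun m => ?_
    obtain ⟨q, rfl⟩ := Submodule.Quotient.mk_surjective _ m
    simp [localizationMulLeft, add_mul]
    rfl

theorem pruferMulLeft_mk (a : R) (q : CentralLocalization T hT) :
    pruferMulLeft T hT a (Submodule.Quotient.mk q) =
      Submodule.Quotient.mk (localizationHom T hT a * q) := rfl

/-- `T⁻¹R / R` is presented by the classes of the inverses of the elements of `T`. -/
theorem isCentralPresentation_prufer :
    IsCentralPresentation (pruferMulLeft T hT) T
      fun τ => Submodule.Quotient.mk (Ring.inverse (localizationHom T hT τ)) where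
  central := hT
  act σ hσ τ hτ := by
    rw [pruferMulLeft_mk]
    congr 1
    apply (isUnit_localizationHom T hT hτ).mul_left_cancel
    rw [← mul_assoc, ← map_mul, ← Submonoid.mem_center_iff.mp (hT hτ) σ,
      Ring.mul_inverse_cancel _ (isUnit_localizationHom T hT (T.mul_mem hσ hτ)),
      Ring.mul_inverse_cancel _ (isUnit_localizationHom T hT hτ)]
  gen m := by
    obtain ⟨q, rfl⟩ := Submodule.Quotient.mk_surjective _ m
    obtain ⟨τ, hτ, a, ha⟩ := exists_mul_localizationHom T hT q
    refine ⟨τ, hτ, a, ?_⟩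
    rw [pruferMulLeft_mk, ← ha, (commute_localizationHom T hT hτ q).eq, mul_assoc,
      Ring.mul_inverse_cancel _ (isUnit_localizationHom T hT hτ), mul_one]
  ker τ hτ a ha := by
    rw [pruferMulLeft_mk, Submodule.Quotient.mk_eq_zero, mem_range_localizationLinearMap] at ha
    obtain ⟨b, hb⟩ := ha
    refine ⟨b, ?_⟩
    have : localizationHom T hT a = localizationHom T hT (τ * b) := by
      rw [map_mul, (commute_localizationHom T hT hτ _).eq, hb, mul_assoc,
        Ring.inverse_mul_cancel _ (isUnit_localizationHom T hT hτ), mul_one]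
    refine LinearMap.ext fun m => ?_
    obtain ⟨q, rfl⟩ := Submodule.Quotient.mk_surjective _ m
    rw [pruferMulLeft_mk, pruferMulLeft_mk, this]
  zero := by
    rw [map_one, Ring.inverse_one, Submodule.Quotient.mk_eq_zero, mem_range_localizationLinearMap]
    exact ⟨1, map_one _⟩
  comm a := by
    refine ⟨MulOpposite.op a, fun τ hτ => ?_⟩
    rw [pruferMulLeft_mk, ← Submodule.Quotient.mk_smul, smul_localization, MulOpposite.unop_op]
    congr 1
    apply (isUnit_localizationHom T hT hτ).mul_left_cancel
    rw [← mul_assoc, Ring.mul_inverse_cancel _ (isUnit_localizationHom T hT hτ), one_mul,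
      (commute_localizationHom T hT hτ _).eq, mul_assoc,
      Ring.inverse_mul_cancel _ (isUnit_localizationHom T hT hτ), mul_one]

end Localization

/-! ### The category of finite powers of `M` over a direct system. -/

section PowersOver

open Limits

variable {S R M : Type u} [Ring S] [Ring R] [AddCommGroup M] [Module S M]
  (ℓ : R →+* Module.End S M) {I : Type (max u v)} [PartialOrder I]
  (D : I ⥤ ModuleCat.{max u v} S)

theorem preservesColimitsOfShape_forget_moduleCat (J : Type (max u v)) [SmallCategory J]
    [IsFiltered J] : PreservesColimitsOfShape J (forget (ModuleCat.{max u v} S)) :=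
  inferInstanceAs (PreservesColimitsOfShape J
    (forget₂ (ModuleCat.{max u v} S) AddCommGrpCat.{max u v} ⋙ forget AddCommGrpCat.{max u v}))

/-- The finite powers of `M` over the terms of the direct system `D`. -/
structure PowerOver (ℓ : R →+* Module.End S M) (D : I ⥤ ModuleCat.{max u v} S) :
    Type (max u v) where
  index : I
  rank : ℕ
  map : (Fin rank → M) →ₗ[S] D.obj index

namespace PowerOver

variable {ℓ D}

/-- Morphisms of finite powers of `M` over `D`: maps given by matrices, compatible with the
transition maps of `D`. -/
structure Hom (A B : PowerOver ℓ D) : Type (max u v) where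
  index_le : A.index ≤ B.index
  lin : (Fin A.rank → M) →ₗ[S] (Fin B.rank → M)
  -- The matrix itself is not part of the data: matrices with the same action give one morphism,
  -- matching flatness modulo the kernel of `ℓ`.
  exists_matrix : ∃ C : Matrix (Fin B.rank) (Fin A.rank) R, lin = matrixMap ℓ C
  comm : B.map ∘ₗ lin = (D.map (homOfLE index_le)).hom ∘ₗ A.map

theorem Hom.ext' {A B : PowerOver ℓ D} {f g : Hom A B} (h : f.lin = g.lin) : f = g := by
  cases f
  cases g
  subst h
  rfl

instance : SmallCategory (PowerOver ℓ D) where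
  Hom := Hom
  id A :=
    { index_le := le_rfl
      lin := LinearMap.id
      exists_matrix := ⟨1, (matrixMap_one ℓ).symm⟩
      comm := by
        rw [show D.map (homOfLE (le_refl A.index)) = 𝟙 _ from D.map_id _]
        rfl }
  comp f g :=
    { index_le := f.index_le.trans g.index_le
      lin := g.lin ∘ₗ f.lin
      exists_matrix := by
        obtain ⟨C, hC⟩ := f.exists_matrix
        obtain ⟨C', hC'⟩ := g.exists_matrix
        exact ⟨C' * C, by rw [matrixMap_mul, hC, hC']⟩
      comm := by
        rw [← LinearMap.comp_assoc, g.comm, LinearMap.comp_assoc, f.comm, ← LinearMap.comp_assoc,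
          ← homOfLE_comp f.index_le g.index_le, D.map_comp, ModuleCat.hom_comp] }

/-- The functor sending a power of `M` over `D` to that power of `M`. -/
def toModuleCat : PowerOver ℓ D ⥤ ModuleCat.{max u v} S where
  obj A := ModuleCat.of S (ULift.{max u v} (Fin A.rank → M))
  map f := ModuleCat.ofHom
    (ULift.moduleEquiv.symm.toLinearMap ∘ₗ f.lin ∘ₗ ULift.moduleEquiv.toLinearMap)
  map_id _ := rfl
  map_comp _ _ := rfl

/-- The tautological cocone of `toModuleCat` over a cocone of `D`. -/
def cocone (c : Cocone D) : Cocone (toModuleCat (ℓ := ℓ) (D := D)) where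
  pt := c.pt
  ι :=
    { app := fun A => ModuleCat.ofHom
        ((c.ι.app A.index).hom ∘ₗ A.map ∘ₗ ULift.moduleEquiv.toLinearMap)
      naturality := fun A B f => by
        ext x
        have h1 := LinearMap.congr_fun f.comm x.down
        have h2 := congr_arg (fun g => g.hom (A.map x.down)) (c.w (homOfLE f.index_le))
        exact (congr_arg (c.ι.app B.index).hom h1).trans h2 }

/-- The hypothesis is the equational form of flatness. It coequalizes parallel arrows when applied
to the difference of their matrices; upper bounds of objects need only direct sums. -/
theorem isFiltered [IsDirectedOrder I] [Nonempty I]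
    (h : ∀ (i : I) (n p : ℕ) (f : (Fin p → M) →ₗ[S] D.obj i) (C : Matrix (Fin p) (Fin n) R),
      f ∘ₗ matrixMap ℓ C = 0 → ∃ (q : ℕ) (C' : Matrix (Fin q) (Fin p) R)
        (g : (Fin q → M) →ₗ[S] D.obj i),
        f = g ∘ₗ matrixMap ℓ C' ∧ matrixMap ℓ C' ∘ₗ matrixMap ℓ C = 0) :
    IsFiltered (PowerOver ℓ D) where
  cocone_objs A B := by
    obtain ⟨k, hA, hB⟩ := exists_ge_ge A.index B.index
    obtain ⟨q, C, C', g, hC, hC'⟩ := exists_common_factor ℓ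
      ((D.map (homOfLE hA)).hom ∘ₗ A.map) ((D.map (homOfLE hB)).hom ∘ₗ B.map)
    exact ⟨⟨k, q, g⟩, ⟨hA, _, ⟨C, rfl⟩, hC⟩, ⟨hB, _, ⟨C', rfl⟩, hC'⟩, trivial⟩
  cocone_maps A B f g := by
    obtain ⟨C, hC⟩ := f.exists_matrix
    obtain ⟨C', hC'⟩ := g.exists_matrix
    obtain ⟨q, E, b, hb, hE⟩ := h B.index _ _ B.map (C - C') (by
      rw [matrixMap_sub, LinearMap.comp_sub, ← hC, ← hC', f.comm, g.comm, sub_self])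
    refine ⟨⟨B.index, q, b⟩, ⟨le_rfl, matrixMap ℓ E, ⟨E, rfl⟩, ?_⟩, Hom.ext' ?_⟩
    · rw [← hb, show D.map (homOfLE (le_refl B.index)) = 𝟙 _ from D.map_id _]
      rfl
    · rw [matrixMap_sub, LinearMap.comp_sub, ← hC, ← hC', sub_eq_zero] at hE
      exact hE
  nonempty := ⟨⟨Classical.arbitrary I, 0, 0⟩⟩

/-- The colimit of `D` is the colimit of the powers of `M` over `D`. -/
theorem nonempty_isColimit [IsDirectedOrder I] [Nonempty I] [IsFiltered (PowerOver ℓ D)]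
    (hsurj : ∀ (i : I) (y : D.obj i), ∃ (n : ℕ) (g : (Fin n → M) →ₗ[S] D.obj i) (m : Fin n → M),
      g m = y)
    (hinj : ∀ (i : I) (p : ℕ) (f : (Fin p → M) →ₗ[S] D.obj i) (m : Fin p → M),
      f m = 0 → ∃ (q : ℕ) (C : Matrix (Fin q) (Fin p) R) (g : (Fin q → M) →ₗ[S] D.obj i),
        f = g ∘ₗ matrixMap ℓ C ∧ matrixMap ℓ C m = 0)
    {c : Cocone D} (hc : IsColimit c) : Nonempty (IsColimit (cocone (ℓ := ℓ) c)) := by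
  have := preservesColimitsOfShape_forget_moduleCat.{u, v} (S := S) I
  have := preservesColimitsOfShape_forget_moduleCat.{u, v} (S := S) (PowerOver ℓ D)
  have hc' := isColimitOfPreserves (forget (ModuleCat.{max u v} S)) hc
  suffices H : IsColimit ((forget (ModuleCat.{max u v} S)).mapCocone (cocone (ℓ := ℓ) c)) by
    have : ReflectsColimitsOfShape (PowerOver ℓ D) (forget (ModuleCat.{max u v} S)) :=
      reflectsColimitsOfShape_of_reflectsIsomorphisms
    exact ⟨isColimitOfReflects (forget (ModuleCat.{max u v} S)) H⟩
  apply Types.FilteredColimit.isColimitOf'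
  · intro x
    obtain ⟨i, y, hy⟩ := Types.jointly_surjective_of_isColimit hc' x
    obtain ⟨n, g, m, hm⟩ := hsurj i y
    refine ⟨⟨i, n, g⟩, ULift.up m, ?_⟩
    rw [← hy, ← hm]
    rfl
  · intro A x y hxy
    -- By linearity, identifying `x` with `y` amounts to killing their difference, first in some
    -- term of `D` and then, by `hinj`, by a matrix.
    have h1 : (c.ι.app A.index).hom (A.map (x.down - y.down)) = (c.ι.app A.index).hom 0 := by
      rw [map_sub, map_sub, map_zero, sub_eq_zero]
      exact hxy
    obtain ⟨j, φ, hφ⟩ := (Types.FilteredColimit.isColimit_eq_iff' hc' _ _).mp h1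
    have h2 : ((D.map φ).hom ∘ₗ A.map) (x.down - y.down) = 0 :=
      hφ.trans (map_zero (D.map φ).hom)
    obtain ⟨q, C, g, hg, hC⟩ := hinj j _ _ _ h2
    refine ⟨⟨j, q, g⟩, ⟨leOfHom φ, matrixMap ℓ C, ⟨C, rfl⟩, hg.symm⟩, ?_⟩
    rw [map_sub, sub_eq_zero] at hC
    exact congr_arg ULift.up hC

end PowerOver

end PowersOver

/-! ### Comparison of the two direct limit classes. -/

section Classes

variable {S : Type u} [Ring S]

theorem directLimitClass_mono {C C' : ObjectProperty (ModuleCat.{w} S)} (h : C ≤ C') :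
    directLimitClass C ≤ directLimitClass C' := by
  rintro L ⟨I, h₁, h₂, h₃, hL⟩
  exact ⟨I, h₁, h₂, h₃, ObjectProperty.colimitsOfShape_monotone I h L hL⟩

theorem addClass_le_AddClass (M : Type v) [AddCommGroup M] [Module S M] :
    addClass.{u, v, w} (S := S) M ≤ AddClass M := by
  rintro N ⟨n, i, p, hp⟩
  let ε : (ULift.{w} (Fin n) →₀ M) ≃ₗ[S] (Fin n → M) :=
    Finsupp.linearEquivFunOnFinite S M (ULift.{w} (Fin n)) ≪≫ₗ
      LinearEquiv.funCongrLeft S M Equiv.ulift.symm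
  refine ⟨ULift.{w} (Fin n), ε.symm.toLinearMap ∘ₗ i, p ∘ₗ ε.toLinearMap, ?_⟩
  rw [← hp]
  refine LinearMap.ext fun x => ?_
  simp

variable {R M : Type u} [Ring R] [IsNoetherianRing R] [AddCommGroup M] [Module S M]
  {ℓ : R →+* Module.End S M} {T : Submonoid R} {e : R → M}

theorem IsCentralPresentation.directLimitClass_eq (h : IsCentralPresentation ℓ T e)
    (hT : (T : Set R).Countable) :
    directLimitClass (addClass.{u, u, max u v} (S := S) M) = directLimitClass (AddClass M) := by
  refine le_antisymm (directLimitClass_mono (addClass_le_AddClass M)) ?_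
  rintro L ⟨I, _, _, _, ⟨P⟩⟩
  choose X hX using P.prop_diag_obj
  have : IsFiltered (PowerOver ℓ P.diag) :=
    PowerOver.isFiltered fun i _ _ f C => h.exists_factor_matrixMap hT (hX i) f C
  obtain ⟨hcolim⟩ := PowerOver.nonempty_isColimit (ℓ := ℓ)
    (fun i y => exists_mem_image_power (hX i) y)
    (fun i _ f m => h.exists_factor_apply hT (hX i) f m) P.isColimit
  -- A directed poset with a final functor to the filtered category replaces it as index, as
  -- `directLimitClass` requires.
  obtain ⟨α, h₁, h₂, h₃, G, _⟩ := IsFiltered.exists_directed (PowerOver ℓ P.diag)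
  refine ⟨α, h₁, h₂, h₃, ObjectProperty.colimitsOfShape_le_of_final _ G _ ?_⟩
  exact ⟨{
    diag := PowerOver.toModuleCat
    ι := (PowerOver.cocone (ℓ := ℓ) P.cocone).ι
    isColimit := hcolim
    prop_diag_obj := fun A => ⟨A.rank, ULift.moduleEquiv.toLinearMap,
      ULift.moduleEquiv.symm.toLinearMap, rfl⟩ }⟩

end Classes

theorem mainTheorem9 {R : Type u} [Ring R] [IsNoetherianRing R] :
    (∀ (t : R) (ht : t ∈ Submonoid.center R),
      directLimitClass (addClass.{u, u, max u v} (S := Rᵐᵒᵖ)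
          (GeneralizedPrufer (Submonoid.powers t) (Submonoid.powers_le.mpr ht))) =
        directLimitClass (AddClass.{u, u, max u v} (S := Rᵐᵒᵖ)
          (GeneralizedPrufer (Submonoid.powers t) (Submonoid.powers_le.mpr ht)))) ∧
    (∀ (T : Submonoid R) (hT : T ≤ Submonoid.center R), (T : Set R).Countable →
      directLimitClass (addClass.{u, u, max u v} (S := Rᵐᵒᵖ) (GeneralizedPrufer T hT)) =
        directLimitClass (AddClass.{u, u, max u v} (S := Rᵐᵒᵖ) (GeneralizedPrufer T hT))) := by
  have key (T : Submonoid R) (hT : T ≤ Submonoid.center R) (hc : (T : Set R).Countable) :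
      directLimitClass (addClass.{u, u, max u v} (S := Rᵐᵒᵖ) (GeneralizedPrufer T hT)) =
        directLimitClass (AddClass.{u, u, max u v} (S := Rᵐᵒᵖ) (GeneralizedPrufer T hT)) :=
    (isCentralPresentation_prufer T hT).directLimitClass_eq hc
  exact ⟨fun t ht => key _ _ (Set.countable_range (fun n : ℕ => t ^ n)), key⟩
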